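/- **Proposition (zero entropy measures).** Let $X$ be a compact metric space with metric $d$ and let $T\colon X\to X$ be continuous. Assume that $(X,T)$ is transitive, i.e. for any nonempty open $U,V\subset X$ there is $n>0$ with $T^n(U)\cap V\neq\emptyset$, and that it has the shadowing property, i.e. for every $\varepsilon>0$ there is $\delta>0$ such that for every sequence $(x_n)_{n\ge 0}$ in $X$ with $d(T(x_n),x_{n+1})<\delta$ for all $n\ge 0$ there is $y\in X$ with $d(T^n(y),x_n)<\varepsilon$ for all $n\ge 0$. Let $M_T(X)$ be the space of $T$-invariant Borel probability measures on $X$ with the weak-$*$ topology, and for $\mu\in M_T(X)$ let $h_\mu(T)\in[0,\infty]$ be the measure-theoretic (Kolmogorov–Sinai) entropy. Then the set $\{\mu\in M_T(X): h_\mu(T)=0\}$ is dense in $M_T(X)$. If, in addition, the entropy function $M_T(X)\to[0,\infty]$, $\mu\mapsto h_\mu(T)$, is upper semicontinuous, then this set is residual in $M_T(X)$, i.e. it contains a dense $G_\delta$ subset of $M_T(X)$. -/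

import Mathlib

open MeasureTheory Filter Topology
open scoped ENNReal

namespace TopDyn

/-- Topological transitivity: for any two nonempty open sets `U`, `V` there is `n > 0` with
`T^n(U) ∩ V ≠ ∅`. -/
def IsTransitive {X : Type*} [TopologicalSpace X] (T : X → X) : Prop :=
  ∀ U V : Set X, IsOpen U → IsOpen V → U.Nonempty → V.Nonempty →
    ∃ n : ℕ, 0 < n ∧ ((T^[n] '' U) ∩ V).Nonempty

/-- `x` is a `δ`-pseudo-orbit of `T`. -/
def IsPseudoOrbit {X : Type*} [MetricSpace X] (T : X → X) (δ : ℝ) (x : ℕ → X) : Prop :=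
  ∀ n : ℕ, dist (T (x n)) (x (n + 1)) < δ

/-- The sequence `x` is `ε`-traced by the point `y`. -/
def IsTracedBy {X : Type*} [MetricSpace X] (T : X → X) (ε : ℝ) (x : ℕ → X) (y : X) : Prop :=
  ∀ n : ℕ, dist (T^[n] y) (x n) < ε

/-- The shadowing property. -/
def HasShadowing {X : Type*} [MetricSpace X] (T : X → X) : Prop :=
  ∀ ε : ℝ, 0 < ε → ∃ δ : ℝ, 0 < δ ∧
    ∀ x : ℕ → X, IsPseudoOrbit T δ x → ∃ y : X, IsTracedBy T ε x y

/-- The set `M_T(X)` of `T`-invariant probability measures; as a subtype of `ProbabilityMeasure X`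
it carries the weak-* topology. -/
def invariantMeasures {X : Type*} [MeasurableSpace X] (T : X → X) :
    Set (ProbabilityMeasure X) :=
  {μ | MeasurePreserving T (μ : Measure X) (μ : Measure X)}

/-- A finite measurable partition of `X` into `k` (possibly empty) cells is given by its measurable
label function `ξ : X → Fin k`. The cells of the join of `ξ, T⁻¹ξ, …, T^{-(n-1)}ξ` are the sets of
points with a prescribed itinerary `w` of length `n`. -/
def itineraryCell {X : Type*} (T : X → X) {k : ℕ} (ξ : X → Fin k) (n : ℕ)
    (w : Fin n → Fin k) : Set X :=
  {x | ∀ i : Fin n, ξ (T^[i] x) = w i}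

/-- The Shannon entropy `H_μ(ξ ∨ T⁻¹ξ ∨ … ∨ T^{-(n-1)}ξ) = -∑ μ(A) log μ(A)`, the sum running over
the cells `A` of the join. -/
noncomputable def joinEntropy {X : Type*} [MeasurableSpace X] (T : X → X) (μ : Measure X)
    {k : ℕ} (ξ : X → Fin k) (n : ℕ) : ℝ :=
  ∑ w : Fin n → Fin k, Real.negMulLog (μ.real (itineraryCell T ξ n w))

/-- The entropy `h_μ(T, ξ) = lim (1/n) H_μ(ξ ∨ T⁻¹ξ ∨ … ∨ T^{-(n-1)}ξ)` of `T` with respect to the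
partition `ξ`. For invariant `μ` the limit exists by subadditivity, and so it is the limsup. -/
noncomputable def partitionEntropy {X : Type*} [MeasurableSpace X] (T : X → X) (μ : Measure X)
    {k : ℕ} (ξ : X → Fin k) : ℝ≥0∞ :=
  limsup (fun n : ℕ => ENNReal.ofReal (joinEntropy T μ ξ n / n)) atTop

/-- The Kolmogorov–Sinai entropy `h_μ(T) ∈ [0, ∞]`: the supremum of `h_μ(T, ξ)` over all finite
measurable partitions `ξ`. -/
noncomputable def entropy {X : Type*} [MeasurableSpace X] (T : X → X) (μ : Measure X) : ℝ≥0∞ :=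
  ⨆ (k : ℕ) (ξ : X → Fin k) (_ : Measurable ξ), partitionEntropy T μ ξ

/-- The set of invariant measures of zero entropy, as a subset of the space `M_T(X)`. -/
def zeroEntropyMeasures {X : Type*} [MeasurableSpace X] (T : X → X) :
    Set (invariantMeasures T) :=
  {μ | entropy T ((μ : ProbabilityMeasure X) : Measure X) = 0}

end TopDyn

/-!
Transitivity and compactness connect any two points by `δ`-pseudo-orbits of bounded length. Long
orbit segments started at points sampled independently from `μ` can therefore be joined into a
periodic pseudo-orbit whose averages are close to the integrals against `μ`, by the law of large
numbers. Shadowing replaces a periodic pseudo-orbit by one with a smaller gap, since the tracing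
orbit returns close to itself at some multiple of the period; iterating this with summable errors
gives in the limit a true orbit that stays close to the original pseudo-orbit and is, at every
scale, uniformly close to a periodic sequence.

Limits of the empirical measures of such a point are invariant measures close to `μ`. Almost
everywhere for such a limit, at every scale `r` there is `N` with all `T^(mN) x` within `r` of `x`,
so the `i`-th label of a partition agrees with the `(i mod N)`-th label off a set of small measure.
The itinerary of length `n` is then determined by its first `N` labels and `n` corrections of small
entropy, and the entropy vanishes. Upper semicontinuity of the entropy makes its zero set a `Gδ`.
-/

namespace TopDyn

section ShannonEntropy

/-- The Shannon entropy, in nats, of the distribution of a random variable `f` with values in a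
finite type. With `f` the itinerary map of a partition it is the entropy of a join of preimages. -/
noncomputable def shannonEntropy {Ω α : Type*} [MeasurableSpace Ω] [Fintype α] (μ : Measure Ω)
    (f : Ω → α) : ℝ :=
  ∑ a, Real.negMulLog (μ.real (f ⁻¹' {a}))

theorem negMulLog_le_neg_mul_log_add_sub {p q : ℝ} (hp : 0 ≤ p) (hq : 0 ≤ q)
    (hpq : q = 0 → p = 0) : Real.negMulLog p ≤ -(p * Real.log q) + (q - p) := by
  rcases hp.eq_or_lt with rfl | hp
  · simpa using hq
  have hq : 0 < q := hq.lt_of_ne fun h => hp.ne' (hpq h.symm)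
  have hlog : Real.log q - Real.log p ≤ q / p - 1 := by
    rw [← Real.log_div hq.ne' hp.ne']
    exact Real.log_le_sub_one_of_pos (div_pos hq hp)
  have hmul : p * (Real.log q - Real.log p) ≤ q - p := by
    calc p * (Real.log q - Real.log p) ≤ p * (q / p - 1) := by gcongr
      _ = q - p := by field_simp
  rw [Real.negMulLog]
  linarith

/-- Gibbs' inequality. -/
theorem sum_negMulLog_le_neg_sum_mul_log {α : Type*} [Fintype α] {p q : α → ℝ}
    (hp : ∀ a, 0 ≤ p a) (hq : ∀ a, 0 ≤ q a) (hpq : ∀ a, q a = 0 → p a = 0)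
    (hsum : ∑ a, q a ≤ ∑ a, p a) :
    ∑ a, Real.negMulLog (p a) ≤ -∑ a, p a * Real.log (q a) := by
  calc ∑ a, Real.negMulLog (p a) ≤ ∑ a, (-(p a * Real.log (q a)) + (q a - p a)) :=
        Finset.sum_le_sum fun a _ => negMulLog_le_neg_mul_log_add_sub (hp a) (hq a) (hpq a)
    _ = -∑ a, p a * Real.log (q a) + (∑ a, q a - ∑ a, p a) := by
        rw [Finset.sum_add_distrib, Finset.sum_neg_distrib, Finset.sum_sub_distrib]
    _ ≤ -∑ a, p a * Real.log (q a) := by linarith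

theorem shannonEntropy_eq_neg_sum {Ω α : Type*} [MeasurableSpace Ω] [Fintype α] (μ : Measure Ω)
    (f : Ω → α) :
    shannonEntropy μ f = -∑ a, μ.real (f ⁻¹' {a}) * Real.log (μ.real (f ⁻¹' {a})) := by
  simp only [shannonEntropy, Real.negMulLog, neg_mul, Finset.sum_neg_distrib]

variable {Ω α β : Type*} [MeasurableSpace Ω] [Fintype α] [MeasurableSpace α]
  [MeasurableSingletonClass α] [Fintype β] [MeasurableSpace β] [MeasurableSingletonClass β]
  {μ : Measure Ω}

theorem integral_comp_eq_sum_measureReal_mul [IsFiniteMeasure μ] {f : Ω → α} (hf : Measurable f)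
    (u : α → ℝ) : ∫ x, u (f x) ∂μ = ∑ a, μ.real (f ⁻¹' {a}) * u a := by
  rw [← integral_map hf.aemeasurable Measurable.of_discrete.aestronglyMeasurable,
    integral_fintype .of_finite]
  simp only [map_measureReal_apply hf (measurableSet_singleton _), smul_eq_mul]

theorem sum_measureReal_mul_comp [IsFiniteMeasure μ] {f : Ω → β} (hf : Measurable f) (φ : β → α)
    (u : α → ℝ) :
    ∑ b, μ.real (f ⁻¹' {b}) * u (φ b) = ∑ a, μ.real ((φ ∘ f) ⁻¹' {a}) * u a :=
  (integral_comp_eq_sum_measureReal_mul hf (u ∘ φ)).symm.trans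
    (integral_comp_eq_sum_measureReal_mul (Measurable.of_discrete.comp hf) u)

theorem sum_measureReal_preimage_singleton_eq_one [IsProbabilityMeasure μ] {f : Ω → α}
    (hf : Measurable f) : ∑ a, μ.real (f ⁻¹' {a}) = 1 := by
  simpa using (integral_comp_eq_sum_measureReal_mul (μ := μ) hf 1).symm

theorem shannonEntropy_comp_le [IsFiniteMeasure μ] {f : Ω → β} (hf : Measurable f) (φ : β → α) :
    shannonEntropy μ (φ ∘ f) ≤ shannonEntropy μ f := by
  rw [shannonEntropy_eq_neg_sum, shannonEntropy_eq_neg_sum, neg_le_neg_iff,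
    ← sum_measureReal_mul_comp hf φ fun a => Real.log (μ.real ((φ ∘ f) ⁻¹' {a}))]
  refine Finset.sum_le_sum fun b _ => ?_
  rcases (measureReal_nonneg (μ := μ) (s := f ⁻¹' {b})).eq_or_lt with h | h
  · simp [← h]
  · have hsub : f ⁻¹' {b} ⊆ (φ ∘ f) ⁻¹' {φ b} := fun x hx => congrArg φ hx
    gcongr
    exact measure_ne_top _ _

theorem shannonEntropy_le_log_card [IsProbabilityMeasure μ] {f : Ω → α} (hf : Measurable f) :
    shannonEntropy μ f ≤ Real.log (Fintype.card α) := by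
  have hα : (Fintype.card α : ℝ) ≠ 0 := by
    obtain ⟨x⟩ := μ.nonempty_of_neZero
    have : Nonempty α := ⟨f x⟩
    exact_mod_cast Fintype.card_ne_zero
  have hsum := sum_measureReal_preimage_singleton_eq_one (μ := μ) hf
  refine (sum_negMulLog_le_neg_sum_mul_log (q := fun _ => (Fintype.card α : ℝ)⁻¹)
    (fun _ => measureReal_nonneg) (fun _ => by positivity) (fun _ h => absurd h (inv_ne_zero hα))
    ?_).trans_eq ?_
  · simp [hsum, hα]
  · rw [← Finset.sum_mul, hsum, Real.log_inv, one_mul, neg_neg]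

/-- Gibbs' inequality, comparing the joint distribution with the product of its marginals. -/
theorem shannonEntropy_pi_le {ι : Type*} [Fintype ι] [DecidableEq ι] {α : ι → Type*}
    [∀ i, Fintype (α i)] [∀ i, MeasurableSpace (α i)] [∀ i, MeasurableSingletonClass (α i)]
    [IsProbabilityMeasure μ] {f : ∀ i, Ω → α i} (hf : ∀ i, Measurable (f i)) :
    shannonEntropy μ (fun x i => f i x) ≤ ∑ i, shannonEntropy μ (f i) := by
  set joint : (∀ i, α i) → ℝ := fun w => μ.real ((fun x i => f i x) ⁻¹' {w})
  set marginal : ∀ i, α i → ℝ := fun i a => μ.real (f i ⁻¹' {a})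
  have hjoint : Measurable fun x i => f i x := measurable_pi_lambda _ hf
  have joint_le_marginal : ∀ w i, joint w ≤ marginal i (w i) := fun w i =>
    measureReal_mono fun x hx => congrFun hx i
  have joint_eq_zero : ∀ w i, marginal i (w i) = 0 → joint w = 0 := fun w i h =>
    le_antisymm (h ▸ joint_le_marginal w i) measureReal_nonneg
  have sum_product : ∑ w : ∀ i, α i, ∏ i, marginal i (w i) = 1 := by
    rw [← Fintype.piFinset_univ, ← Finset.prod_univ_sum]
    exact Finset.prod_eq_one fun i _ => sum_measureReal_preimage_singleton_eq_one (hf i)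
  calc shannonEntropy μ (fun x i => f i x)
      ≤ -∑ w, joint w * Real.log (∏ i, marginal i (w i)) := by
        refine sum_negMulLog_le_neg_sum_mul_log (fun _ => measureReal_nonneg)
          (fun w => Finset.prod_nonneg fun i _ => measureReal_nonneg) (fun w hw => ?_) ?_
        · obtain ⟨i, -, hi⟩ := Finset.prod_eq_zero_iff.1 hw
          exact joint_eq_zero w i hi
        · rw [sum_product, sum_measureReal_preimage_singleton_eq_one hjoint]
    _ = -∑ w, ∑ i, joint w * Real.log (marginal i (w i)) := by
        refine congrArg Neg.neg (Finset.sum_congr rfl fun w _ => ?_)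
        by_cases hw : joint w = 0
        · simp [hw]
        · rw [Real.log_prod fun i _ hi => hw (joint_eq_zero w i hi), Finset.mul_sum]
    _ = ∑ i, -∑ w, joint w * Real.log (marginal i (w i)) := by
        rw [Finset.sum_comm, Finset.sum_neg_distrib]
    _ = ∑ i, shannonEntropy μ (f i) := by
        refine Finset.sum_congr rfl fun i _ => ?_
        rw [shannonEntropy_eq_neg_sum]
        exact congrArg Neg.neg
          (sum_measureReal_mul_comp hjoint (· i) fun a => Real.log (marginal i a))

/-- A family is determined by reference variables and its differences from them. -/
theorem shannonEntropy_pi_le_add_sum_sub {ι κ : Type*} [Fintype ι] [DecidableEq ι] [Fintype κ]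
    [AddGroup α] [IsProbabilityMeasure μ] {f : ι → Ω → α} {g : κ → Ω → α}
    (hf : ∀ i, Measurable (f i)) (hg : ∀ j, Measurable (g j)) (τ : ι → κ) :
    shannonEntropy μ (fun x i => f i x) ≤
      ∑ j, shannonEntropy μ (g j) + ∑ i, shannonEntropy μ (f i - g (τ i)) := by
  classical
  let code : κ ⊕ ι → Ω → α := Sum.elim g fun i => f i - g (τ i)
  let decode : (κ ⊕ ι → α) → ι → α := fun w i => w (.inr i) + w (.inl (τ i))
  have hcode : ∀ s, Measurable (code s) := by
    rintro (j | i)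
    · exact hg j
    · exact (Measurable.of_discrete (f := fun q : α × α => q.1 - q.2)).comp
        ((hf i).prodMk (hg (τ i)))
  have hdecode : (fun x i => f i x) = decode ∘ fun x s => code s x := by
    funext x i
    simp [code, decode]
  calc shannonEntropy μ (fun x i => f i x)
      ≤ shannonEntropy μ (fun x s => code s x) :=
        hdecode ▸ shannonEntropy_comp_le (measurable_pi_lambda _ hcode) decode
    _ ≤ ∑ s, shannonEntropy μ (code s) := shannonEntropy_pi_le hcode
    _ = _ := Fintype.sum_sum_type _

theorem exists_forall_shannonEntropy_le (a₀ : α) {η : ℝ} (hη : 0 < η) :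
    ∃ p > 0, ∀ (μ : Measure Ω) [IsProbabilityMeasure μ] (f : Ω → α), Measurable f →
      μ.real {x | f x ≠ a₀} ≤ p → shannonEntropy μ f ≤ η := by
  classical
  let H : (α → ℝ) → ℝ := fun P => ∑ a, Real.negMulLog (P a)
  have hH : Continuous H := continuous_finsetSum _ fun a _ =>
    Real.continuous_negMulLog.comp (continuous_apply a)
  have hH₀ : H (Pi.single a₀ 1) = 0 := by
    refine Finset.sum_eq_zero fun a _ => ?_
    rcases eq_or_ne a a₀ with rfl | ha <;> simp [*]
  obtain ⟨p, hp, hpH⟩ := Metric.nhds_basis_closedBall.eventually_iff.1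
    (hH.continuousAt.eventually_le_const (hH₀.trans_lt hη))
  refine ⟨p, hp, fun μ _ f hf hfp => hpH <| (dist_pi_le_iff hp.le).2 fun a => ?_⟩
  rw [Real.dist_eq]
  rcases eq_or_ne a a₀ with rfl | ha
  · rw [Pi.single_eq_same, abs_sub_comm,
      ← probReal_compl_eq_one_sub (hf (measurableSet_singleton a)),
      abs_of_nonneg measureReal_nonneg]
    exact hfp
  · rw [Pi.single_eq_of_ne ha, sub_zero, abs_of_nonneg measureReal_nonneg]
    exact (measureReal_mono fun x (hx : f x = a) => hx.trans_ne ha).trans hfp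

end ShannonEntropy

section RegularRecurrence

variable {X : Type*} [MeasurableSpace X] {T : X → X} {μ : Measure X}

theorem joinEntropy_eq_shannonEntropy (T : X → X) (μ : Measure X) {k : ℕ} (ξ : X → Fin k)
    (n : ℕ) : joinEntropy T μ ξ n = shannonEntropy μ fun x (i : Fin n) => ξ (T^[i] x) := by
  simp only [joinEntropy, shannonEntropy, itineraryCell, Set.preimage, Set.mem_singleton_iff,
    funext_iff]

theorem joinEntropy_le_mul_log_add_sum_sub [IsProbabilityMeasure μ] (hT : Measurable T) {k : ℕ}
    [NeZero k] {ξ : X → Fin k} (hξ : Measurable ξ) {N : ℕ} (hN : 0 < N) (n : ℕ) :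
    joinEntropy T μ ξ n ≤
      N * Real.log k + ∑ i : Fin n, shannonEntropy μ (ξ ∘ T^[i] - ξ ∘ T^[i % N]) := by
  have hξT : ∀ i, Measurable (ξ ∘ T^[i]) := fun i => hξ.comp (hT.iterate i)
  have hlog : ∀ j : Fin N, shannonEntropy μ (ξ ∘ T^[j]) ≤ Real.log k := fun j => by
    simpa using shannonEntropy_le_log_card (μ := μ) (hξT j)
  calc joinEntropy T μ ξ n
      ≤ ∑ j : Fin N, shannonEntropy μ (ξ ∘ T^[j]) +
          ∑ i : Fin n, shannonEntropy μ (ξ ∘ T^[i] - ξ ∘ T^[i % N]) :=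
        joinEntropy_eq_shannonEntropy T μ ξ n ▸
          shannonEntropy_pi_le_add_sum_sub (f := fun i : Fin n => ξ ∘ T^[i])
            (g := fun j : Fin N => ξ ∘ T^[j]) (fun i => hξT i) (fun j => hξT j)
            fun i => ⟨i % N, Nat.mod_lt _ hN⟩
    _ ≤ N * Real.log k + ∑ i : Fin n, shannonEntropy μ (ξ ∘ T^[i] - ξ ∘ T^[i % N]) := by
        gcongr
        simpa using Finset.sum_le_sum fun j (_ : j ∈ Finset.univ) => hlog j

theorem partitionEntropy_le_of_joinEntropy_le {k : ℕ} {ξ : X → Fin k} {c h : ℝ}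
    (hle : ∀ n, joinEntropy T μ ξ n ≤ c + n * h) :
    partitionEntropy T μ ξ ≤ ENNReal.ofReal h := by
  have hlim : Tendsto (fun n : ℕ => ENNReal.ofReal (c / n + h)) atTop (𝓝 (ENNReal.ofReal h)) := by
    simpa using ENNReal.tendsto_ofReal ((tendsto_const_div_atTop_nhds_zero_nat c).add_const h)
  rw [← hlim.limsup_eq]
  refine limsup_le_limsup ?_
  filter_upwards [eventually_gt_atTop 0] with n hn
  refine ENNReal.ofReal_le_ofReal ?_
  calc joinEntropy T μ ξ n / n ≤ (c + n * h) / n := by gcongr; exact hle n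
    _ = c / n + h := by field_simp

theorem partitionEntropy_eq_zero_of_almost_periodic [IsProbabilityMeasure μ] (hT : Measurable T)
    {k : ℕ} {ξ : X → Fin k} (hξ : Measurable ξ)
    (h : ∀ p > 0, ∃ N > 0, ∀ i, μ.real {x | ξ (T^[i] x) ≠ ξ (T^[i % N] x)} ≤ p) :
    partitionEntropy T μ ξ = 0 := by
  obtain ⟨x₀⟩ : Nonempty X := μ.nonempty_of_neZero
  have : NeZero k := ⟨fun hk => (hk ▸ ξ x₀ : Fin 0).elim0⟩
  refine le_antisymm (ENNReal.le_of_forall_pos_le_add fun η hη _ => ?_) bot_le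
  obtain ⟨p, hp, hpη⟩ := exists_forall_shannonEntropy_le (Ω := X) (0 : Fin k)
    (NNReal.coe_pos.2 hη)
  obtain ⟨N, hN, hNp⟩ := h p hp
  have hsub : ∀ i, shannonEntropy μ (ξ ∘ T^[i] - ξ ∘ T^[i % N]) ≤ η := fun i => by
    refine hpη μ _ ?_ (by simpa [sub_eq_zero] using hNp i)
    exact (hξ.comp (hT.iterate i)).sub (hξ.comp (hT.iterate _))
  have hjoin : ∀ n : ℕ, joinEntropy T μ ξ n ≤ N * Real.log k + n * η := fun n => by
    refine (joinEntropy_le_mul_log_add_sum_sub hT hξ hN n).trans ?_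
    gcongr
    simpa using Finset.sum_le_sum fun (i : Fin n) (_ : i ∈ Finset.univ) => hsub i
  simpa using partitionEntropy_le_of_joinEntropy_le hjoin

theorem exists_isClosed_subset_preimage_measureReal_compl_le [TopologicalSpace X]
    [TopologicalSpace.PseudoMetrizableSpace X] [BorelSpace X] [IsFiniteMeasure μ] {α : Type*}
    [Finite α] [MeasurableSpace α] [MeasurableSingletonClass α] {ξ : X → α} (hξ : Measurable ξ)
    {p : ℝ} (hp : 0 < p) :
    ∃ F : α → Set X, (∀ a, IsClosed (F a)) ∧ (∀ a, F a ⊆ ξ ⁻¹' {a}) ∧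
      μ.real (⋃ a, F a)ᶜ ≤ p := by
  cases nonempty_fintype α
  set c : ℝ := p / (Fintype.card α + 1)
  have hc : 0 < c := by positivity
  have hcell : ∀ a, ∃ F ⊆ ξ ⁻¹' {a}, IsClosed F ∧ μ (ξ ⁻¹' {a} \ F) < ENNReal.ofReal c :=
    fun a => (hξ (measurableSet_singleton a)).exists_isClosed_sdiff_lt (measure_ne_top _ _)
      (ENNReal.ofReal_pos.2 hc).ne'
  choose F hFξ hF hFc using hcell
  refine ⟨F, hF, hFξ, ?_⟩
  have hsub : (⋃ a, F a)ᶜ ⊆ ⋃ a, ξ ⁻¹' {a} \ F a := fun x hx =>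
    Set.mem_iUnion.2 ⟨ξ x, rfl, fun hxF => hx (Set.mem_iUnion_of_mem _ hxF)⟩
  calc μ.real (⋃ a, F a)ᶜ ≤ μ.real (⋃ a, ξ ⁻¹' {a} \ F a) := measureReal_mono hsub
    _ ≤ ∑ a, μ.real (ξ ⁻¹' {a} \ F a) := measureReal_iUnion_fintype_le _
    _ ≤ ∑ _a : α, c := Finset.sum_le_sum fun a _ =>
        ENNReal.toReal_le_of_le_ofReal hc.le (hFc a).le
    _ = Fintype.card α * c := by simp
    _ ≤ (Fintype.card α + 1) * c := by gcongr; linarith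
    _ = p := mul_div_cancel₀ _ (by positivity)

theorem exists_forall_dist_le_imp_eq {Y α : Type*} [PseudoMetricSpace Y] [CompactSpace Y]
    [Finite α] {F : α → Set Y} (hF : ∀ a, IsClosed (F a))
    (hdisj : Pairwise fun a b => Disjoint (F a) (F b)) :
    ∃ r > 0, ∀ a b, ∀ x ∈ F a, ∀ y ∈ F b, dist x y ≤ r → a = b := by
  have hpair : ∀ a b, ∀ᶠ r in 𝓝[>] (0 : ℝ), ∀ x ∈ F a, ∀ y ∈ F b, dist x y ≤ r → a = b := by
    intro a b
    by_cases hab : a = b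
    · exact .of_forall fun _ _ _ _ _ _ => hab
    obtain ⟨r, hr, hlt⟩ :=
      Metric.exists_pos_forall_lt_edist (hF a).isCompact (hF b) (hdisj hab)
    filter_upwards [Ioo_mem_nhdsGT (NNReal.coe_pos.2 hr)] with s hs x hx y hy hxy
    have : (r : ℝ) < dist x y := by
      rw [← coe_nndist, NNReal.coe_lt_coe, ← ENNReal.coe_lt_coe, ← edist_nndist]
      exact hlt x hx y hy
    exact absurd (this.trans_le hxy) hs.2.not_gt
  obtain ⟨r, hr, hpos⟩ := ((eventually_all.2 fun a => eventually_all.2 (hpair a)).and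
    self_mem_nhdsWithin).exists
  exact ⟨r, hpos, hr⟩

/-- Lusin's theorem and uniform continuity, for functions with finitely many values. -/
theorem exists_measurableSet_forall_dist_le_imp_eq {Y : Type*} [PseudoMetricSpace Y]
    [CompactSpace Y] [MeasurableSpace Y] [BorelSpace Y] (ν : Measure Y) [IsFiniteMeasure ν]
    {α : Type*} [Finite α] [MeasurableSpace α] [MeasurableSingletonClass α] {ξ : Y → α}
    (hξ : Measurable ξ) {p : ℝ} (hp : 0 < p) :
    ∃ G : Set Y, MeasurableSet G ∧ ν.real Gᶜ ≤ p ∧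
      ∃ r > 0, ∀ x ∈ G, ∀ y ∈ G, dist x y ≤ r → ξ x = ξ y := by
  obtain ⟨F, hF, hFξ, hFp⟩ :=
    exists_isClosed_subset_preimage_measureReal_compl_le (μ := ν) hξ hp
  have hdisj : Pairwise fun a b => Disjoint (F a) (F b) := fun a b hab =>
    (Set.disjoint_singleton.2 hab).preimage ξ |>.mono (hFξ a) (hFξ b)
  obtain ⟨r, hr, hFr⟩ := exists_forall_dist_le_imp_eq hF hdisj
  refine ⟨⋃ a, F a, .iUnion fun a => (hF a).measurableSet, hFp, r, hr, fun x hx y hy hxy => ?_⟩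
  obtain ⟨a, ha⟩ := Set.mem_iUnion.1 hx
  obtain ⟨b, hb⟩ := Set.mem_iUnion.1 hy
  rw [show ξ x = a from hFξ a ha, show ξ y = b from hFξ b hb]
  exact hFr a b x ha y hb hxy

theorem measureReal_setOf_iterate_ne_le {Y α : Type*} [PseudoMetricSpace Y] [MeasurableSpace Y]
    {S : Y → Y} {ν : Measure Y} [IsFiniteMeasure ν] (hS : MeasurePreserving S ν ν) {ξ : Y → α}
    {G : Set Y} (hG : MeasurableSet G) {r : ℝ}
    (hξ : ∀ x ∈ G, ∀ y ∈ G, dist x y ≤ r → ξ x = ξ y) {N : ℕ}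
    (hN : ∀ᵐ x ∂ν, ∀ m, dist (S^[m * N] x) x ≤ r) (i : ℕ) :
    ν.real {x | ξ (S^[i] x) ≠ ξ (S^[i % N] x)} ≤ ν.real Gᶜ + ν.real Gᶜ := by
  have hpre : ∀ j, ν.real (S^[j] ⁻¹' Gᶜ) = ν.real Gᶜ := fun j =>
    (hS.iterate j).measureReal_preimage hG.compl.nullMeasurableSet
  have hsub : {x | ξ (S^[i] x) ≠ ξ (S^[i % N] x)} ≤ᵐ[ν]
      (S^[i] ⁻¹' Gᶜ ∪ S^[i % N] ⁻¹' Gᶜ : Set Y) := by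
    filter_upwards [(hS.iterate (i % N)).quasiMeasurePreserving.ae hN] with x hx hne
    by_contra hmem
    have hi : S^[i] x ∈ G := not_not.1 fun hi => hmem (Or.inl hi)
    have hiN : S^[i % N] x ∈ G := not_not.1 fun hiN => hmem (Or.inr hiN)
    refine hne (hξ _ hi _ hiN ?_)
    simpa only [← Function.iterate_add_apply, Nat.div_add_mod'] using hx (i / N)
  calc ν.real {x | ξ (S^[i] x) ≠ ξ (S^[i % N] x)}
      ≤ ν.real (S^[i] ⁻¹' Gᶜ ∪ S^[i % N] ⁻¹' Gᶜ) :=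
        ENNReal.toReal_mono (measure_ne_top _ _) (measure_mono_ae hsub)
    _ ≤ ν.real (S^[i] ⁻¹' Gᶜ) + ν.real (S^[i % N] ⁻¹' Gᶜ) := measureReal_union_le _ _
    _ = ν.real Gᶜ + ν.real Gᶜ := by rw [hpre, hpre]

theorem entropy_eq_zero_of_ae_dist_iterate_le {Y : Type*} [PseudoMetricSpace Y] [CompactSpace Y]
    [MeasurableSpace Y] [BorelSpace Y] {S : Y → Y} {ν : Measure Y} [IsProbabilityMeasure ν]
    (hS : MeasurePreserving S ν ν)
    (h : ∀ r > 0, ∃ N > 0, ∀ᵐ x ∂ν, ∀ m, dist (S^[m * N] x) x ≤ r) :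
    entropy S ν = 0 := by
  simp only [entropy, ENNReal.iSup_eq_zero]
  refine fun k ξ hξ => partitionEntropy_eq_zero_of_almost_periodic hS.measurable hξ fun p hp => ?_
  obtain ⟨G, hG, hGp, r, hr, hGr⟩ :=
    exists_measurableSet_forall_dist_le_imp_eq ν hξ (half_pos hp)
  obtain ⟨N, hN, hNr⟩ := h r hr
  exact ⟨N, hN, fun i =>
    (measureReal_setOf_iterate_ne_le hS hG hGr hNr i).trans (by linarith)⟩

end RegularRecurrence

section Shadowing

variable {X : Type*} [MetricSpace X] {T : X → X} {δ ε : ℝ}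

/-- `x` is a `δ`-pseudo-orbit with period `P > 0`: the finite object to which shadowing is
repeatedly applied. The period need not be minimal. -/
structure IsPeriodicPseudoOrbit (T : X → X) (δ : ℝ) (x : ℕ → X) (P : ℕ) : Prop where
  pos : 0 < P
  periodic : Function.Periodic x P
  isPseudoOrbit : IsPseudoOrbit T δ x

/-- Regular recurrence of `z`, uniformly along its orbit: at every scale `r` the whole orbit is
`N`-periodic up to `r` for some `N > 0`. The uniformity in `n` forces the invariant measures on the
orbit closure to have zero entropy; under plain regular recurrence (`n = 0`) this fails, as Toeplitz
sequences show. -/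
def IsUniformlyRegularlyRecurrent (T : X → X) (z : X) : Prop :=
  ∀ r > 0, ∃ N > 0, ∀ n m, dist (T^[n + m * N] z) (T^[n] z) ≤ r

theorem isPeriodicPseudoOrbit_comp_mod {y : ℕ → X} {P : ℕ} (hP : 0 < P)
    (hstep : ∀ i, i + 1 < P → dist (T (y i)) (y (i + 1)) < δ)
    (hclose : dist (T (y (P - 1))) (y 0) < δ) :
    IsPeriodicPseudoOrbit T δ (fun n => y (n % P)) P := by
  refine ⟨hP, fun n => by simp, fun n => ?_⟩
  rw [← Nat.mod_add_mod]
  rcases (Nat.succ_le_of_lt (Nat.mod_lt n hP)).lt_or_eq with h | h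
  · rw [Nat.mod_eq_of_lt h]
    exact hstep _ h
  · have hlast : n % P = P - 1 := Nat.eq_sub_of_add_eq h
    rwa [← Nat.succ_eq_add_one, h, Nat.mod_self, hlast]

theorem exists_lt_dist_lt [CompactSpace X] (u : ℕ → X) (hδ : 0 < δ) :
    ∃ i j, i < j ∧ dist (u i) (u j) < δ := by
  obtain ⟨a, φ, hφ, ha⟩ := CompactSpace.tendsto_subseq u
  obtain ⟨J, hJ⟩ := Metric.cauchySeq_iff'.1 ha.cauchySeq δ hδ
  exact ⟨φ J, φ (J + 1), hφ J.lt_succ_self, dist_comm (u (φ J)) _ ▸ hJ _ J.le_succ⟩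

/-- The tracing orbit comes back near itself at multiples of the period; cut it there and close it
up. -/
theorem IsTracedBy.exists_isPeriodicPseudoOrbit [CompactSpace X] {x : ℕ → X} {y : X}
    (hy : IsTracedBy T ε x y) {P : ℕ} (hP : 0 < P) (hx : Function.Periodic x P) (hδ : 0 < δ) :
    ∃ x' P', IsPeriodicPseudoOrbit T δ x' P' ∧ ∀ n, dist (x' n) (x n) < ε := by
  obtain ⟨i, j, hij, hdist⟩ := exists_lt_dist_lt (fun j => T^[j * P] y) hδ
  obtain ⟨k, rfl⟩ := Nat.exists_eq_add_of_lt hij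
  have hP' : 0 < (k + 1) * P := by positivity
  have htrace : ∀ n, dist (T^[n] (T^[i * P] y)) (x n) < ε := fun n => by
    rw [← Function.iterate_add_apply, ← hx.nsmul i n, smul_eq_mul]
    exact hy _
  have hreturn : dist (T^[(k + 1) * P] (T^[i * P] y)) (T^[i * P] y) < δ := by
    rwa [← Function.iterate_add_apply, ← add_mul, dist_comm, add_comm, ← add_assoc]
  refine ⟨_, _, isPeriodicPseudoOrbit_comp_mod (y := fun n => T^[n] (T^[i * P] y)) hP' ?_ ?_,
    fun n => ?_⟩
  · intro n _
    rwa [Function.iterate_succ_apply', dist_self]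
  · rw [← Function.iterate_succ_apply' T, Nat.succ_eq_add_one, Nat.sub_add_cancel hP']
    exact hreturn
  · rw [← (hx.nsmul (k + 1)).map_mod_nat]
    exact htrace _

theorem HasShadowing.exists_isPeriodicPseudoOrbit_near [CompactSpace X] (hS : HasShadowing T)
    (hε : 0 < ε) :
    ∃ δ > 0, ∀ x P, IsPeriodicPseudoOrbit T δ x P → ∀ δ' > 0,
      ∃ x' P', IsPeriodicPseudoOrbit T δ' x' P' ∧ ∀ n, dist (x n) (x' n) ≤ ε := by
  obtain ⟨δ, hδ, hshadow⟩ := hS ε hε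
  refine ⟨δ, hδ, fun x P hx δ' hδ' => ?_⟩
  obtain ⟨y, hy⟩ := hshadow x hx.isPseudoOrbit
  obtain ⟨x', P', hx', hdist⟩ := hy.exists_isPeriodicPseudoOrbit hx.pos hx.periodic hδ'
  exact ⟨x', P', hx', fun n => dist_comm (x n) _ ▸ (hdist n).le⟩

theorem IsPeriodicPseudoOrbit.mono {x : ℕ → X} {P : ℕ} (h : IsPeriodicPseudoOrbit T δ x P)
    (hle : δ ≤ ε) : IsPeriodicPseudoOrbit T ε x P :=
  ⟨h.pos, h.periodic, fun n => (h.isPseudoOrbit n).trans_le hle⟩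

theorem HasShadowing.exists_seq_isPeriodicPseudoOrbit [CompactSpace X] (hS : HasShadowing T)
    (hε : 0 < ε) :
    ∃ δ > 0, ∀ x P, IsPeriodicPseudoOrbit T δ x P → ∃ (q : ℕ → ℕ → X) (Q : ℕ → ℕ), q 0 = x ∧
      (∀ j : ℕ, IsPeriodicPseudoOrbit T (1 / (j + 1)) (q j) (Q j)) ∧
      ∀ j n, dist (q j n) (q (j + 1) n) ≤ ε / 2 / 2 ^ j := by
  choose δ hδ hrefine using fun j : ℕ =>
    hS.exists_isPeriodicPseudoOrbit_near (ε := ε / 2 / 2 ^ j) (by positivity)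
  let η : ℕ → ℝ := fun j => min (δ j) (1 / (j + 1))
  have hη : ∀ j, 0 < η j := fun j => lt_min (hδ j) (by positivity)
  let S : ℕ → Type _ := fun j => {q : (ℕ → X) × ℕ // IsPeriodicPseudoOrbit T (η j) q.1 q.2}
  have hstep : ∀ j (s : S j), ∃ s' : S (j + 1), ∀ n,
      dist (s.1.1 n) (s'.1.1 n) ≤ ε / 2 / 2 ^ j := fun j s => by
    obtain ⟨x', P', hx', hdist⟩ := hrefine j _ _ (s.2.mono (min_le_left _ _)) _ (hη (j + 1))
    exact ⟨⟨(x', P'), hx'⟩, hdist⟩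
  choose next hnext using hstep
  refine ⟨η 0, hη 0, fun x P hx => ?_⟩
  let s : ∀ j, S j := Nat.rec ⟨(x, P), hx⟩ next
  exact ⟨fun j => (s j).1.1, fun j => (s j).1.2, rfl,
    fun j => (s j).2.mono (min_le_right _ _), fun j => hnext j (s j)⟩

theorem iterate_eq_of_tendsto_isPseudoOrbit (hT : Continuous T) {η : ℕ → ℝ}
    (hη : Tendsto η atTop (𝓝 0)) {q : ℕ → ℕ → X} (hq : ∀ j, IsPseudoOrbit T (η j) (q j))
    {w : ℕ → X} (hw : ∀ n, Tendsto (fun j => q j n) atTop (𝓝 (w n))) (n : ℕ) :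
    T^[n] (w 0) = w n := by
  have hstep : ∀ n, T (w n) = w (n + 1) := fun n => by
    have hdist := ((hT.tendsto _).comp (hw n)).dist (hw (n + 1))
    exact dist_eq_zero.1 <| tendsto_nhds_unique hdist <|
      squeeze_zero (fun _ => dist_nonneg) (fun j => (hq j n).le) hη
  induction n with
  | zero => rfl
  | succ n ih => rw [Function.iterate_succ_apply', ih, hstep]

theorem isUniformlyRegularlyRecurrent_of_tendstoUniformly {z : X} {q : ℕ → ℕ → X}
    (hq : ∀ j, ∃ P > 0, Function.Periodic (q j) P)
    (h : TendstoUniformly q (fun n => T^[n] z) atTop) : IsUniformlyRegularlyRecurrent T z := by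
  intro r hr
  obtain ⟨j, hj⟩ := (Metric.tendstoUniformly_iff.1 h (r / 2) (half_pos hr)).exists
  obtain ⟨P, hP, hper⟩ := hq j
  refine ⟨P, hP, fun n m => ?_⟩
  have hnm := hj (n + m * P)
  rw [← smul_eq_mul, hper.nsmul m n, smul_eq_mul] at hnm
  linarith [hj n, dist_triangle_right (T^[n + m * P] z) (T^[n] z) (q j n)]

theorem HasShadowing.exists_isUniformlyRegularlyRecurrent [CompactSpace X] (hS : HasShadowing T)
    (hT : Continuous T) (hε : 0 < ε) :
    ∃ δ > 0, ∀ x P, IsPeriodicPseudoOrbit T δ x P →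
      ∃ z, IsUniformlyRegularlyRecurrent T z ∧ ∀ n, dist (T^[n] z) (x n) ≤ ε := by
  obtain ⟨δ, hδ, hseq⟩ := hS.exists_seq_isPeriodicPseudoOrbit hε
  refine ⟨δ, hδ, fun x P hx => ?_⟩
  obtain ⟨q, Q, rfl, hq, hdist⟩ := hseq x P hx
  choose w hw using fun n => cauchySeq_tendsto_of_complete
    (cauchySeq_of_le_geometric_two fun j => hdist j n)
  have hbound : ∀ n j, dist (q j n) (w n) ≤ ε / 2 ^ j := fun n =>
    dist_le_of_le_geometric_two_of_tendsto (fun j => hdist j n) (hw n)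
  have horbit : ∀ n, T^[n] (w 0) = w n := iterate_eq_of_tendsto_isPseudoOrbit hT
    tendsto_one_div_add_atTop_nhds_zero_nat (fun j => (hq j).isPseudoOrbit) hw
  refine ⟨w 0, isUniformlyRegularlyRecurrent_of_tendstoUniformly
    (fun j => ⟨Q j, (hq j).pos, (hq j).periodic⟩) (Metric.tendstoUniformly_iff.2 fun r hr => ?_),
    fun n => ?_⟩
  · have hlim : Tendsto (fun j : ℕ => ε / 2 ^ j) atTop (𝓝 0) :=
      tendsto_const_nhds.div_atTop (tendsto_pow_atTop_atTop_of_one_lt one_lt_two)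
    filter_upwards [hlim.eventually_lt_const hr] with j hj n
    rw [horbit, dist_comm]
    exact (hbound n j).trans_lt hj
  · simpa only [horbit, dist_comm (w n), pow_zero, div_one] using hbound n 0

end Shadowing

section PseudoPath

variable {X : Type*} [MetricSpace X] {T : X → X} {δ : ℝ}

/-- `IsPseudoPath T δ l a b` says that `l` followed by `b` is a finite `δ`-pseudo-orbit from `a` to
`b`. The end point is kept out of the list so that concatenation of paths is `++`. -/
inductive IsPseudoPath (T : X → X) (δ : ℝ) : List X → X → X → Prop
  | nil (a : X) : IsPseudoPath T δ [] a a
  | cons {a b c : X} {l : List X} : dist (T a) b < δ → IsPseudoPath T δ l b c →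
      IsPseudoPath T δ (a :: l) a c

theorem IsPseudoPath.append {l m : List X} {a b c : X} (hl : IsPseudoPath T δ l a b)
    (hm : IsPseudoPath T δ m b c) : IsPseudoPath T δ (l ++ m) a c := by
  induction hl with
  | nil => exact hm
  | cons hab _ ih => exact .cons hab (ih hm)

theorem isPseudoPath_iterate (hδ : 0 < δ) (n : ℕ) (u : X) :
    IsPseudoPath T δ (List.iterate T u n) u (T^[n] u) := by
  induction n generalizing u with
  | zero => exact .nil u
  | succ n ih => exact .cons (dist_self (T u) ▸ hδ) (ih (T u))

theorem IsPseudoPath.getD_zero {l : List X} {a b : X} (h : IsPseudoPath T δ l a b) :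
    l.getD 0 b = a := by
  cases h <;> rfl

theorem IsPseudoPath.dist_getD_lt {l : List X} {a b : X} (h : IsPseudoPath T δ l a b) {i : ℕ}
    (hi : i < l.length) : dist (T (l.getD i b)) (l.getD (i + 1) b) < δ := by
  induction h generalizing i with
  | nil => simp at hi
  | cons hab h ih =>
    cases i with
    | zero => simpa only [List.getD_cons_zero, List.getD_cons_succ, h.getD_zero] using hab
    | succ i => simpa only [List.getD_cons_succ] using ih (Nat.lt_of_succ_lt_succ hi)

theorem IsPseudoPath.isPeriodicPseudoOrbit {l : List X} {p : X} (h : IsPseudoPath T δ l p p)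
    (hl : 0 < l.length) :
    IsPeriodicPseudoOrbit T δ (fun n => l.getD (n % l.length) p) l.length := by
  refine isPeriodicPseudoOrbit_comp_mod (y := fun i => l.getD i p) hl
    (fun i hi => h.dist_getD_lt (Nat.lt_of_succ_lt hi)) ?_
  have hend : l.getD l.length p = p := List.getD_eq_default _ _ le_rfl
  have hlast := h.dist_getD_lt (Nat.sub_lt hl one_pos)
  rw [Nat.sub_one_add_one hl.ne', hend] at hlast
  rwa [h.getD_zero]

theorem IsTransitive.exists_isPseudoPath_of_dist_lt (hT : IsTransitive T) (hδ : 0 < δ) (a b : X) :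
    ∃ K, ∀ x y, dist (T x) a < δ / 2 → dist y b < δ / 2 →
      ∃ l : List X, l.length = K ∧ IsPseudoPath T δ l x y := by
  obtain ⟨n, hn, _, ⟨u, hu, rfl⟩, hv⟩ := hT _ _ Metric.isOpen_ball Metric.isOpen_ball
    (Metric.nonempty_ball (x := a).2 (half_pos hδ)) (Metric.nonempty_ball (x := b).2 (half_pos hδ))
  obtain ⟨m, rfl⟩ := Nat.exists_eq_succ_of_ne_zero hn.ne'
  rw [Metric.mem_ball] at hu hv
  rw [Nat.succ_eq_add_one, Function.iterate_succ_apply'] at hv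
  refine ⟨m + 2, fun x y hx hy => ⟨x :: (List.iterate T u m ++ [T^[m] u]), by simp,
    .cons ?_ ((isPseudoPath_iterate hδ m u).append (.cons ?_ (.nil y)))⟩⟩
  · linarith [dist_triangle_right (T x) u a]
  · linarith [dist_triangle_right (T (T^[m] u)) y b]

theorem IsTransitive.exists_isPseudoPath_length_le [CompactSpace X] (hT : IsTransitive T)
    (hδ : 0 < δ) : ∃ K, ∀ x y, ∃ l : List X, l.length ≤ K ∧ IsPseudoPath T δ l x y := by
  choose k hk using hT.exists_isPseudoPath_of_dist_lt hδ
  obtain ⟨t, -, htfin, htcover⟩ :=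
    Metric.finite_approx_of_totallyBounded (isCompact_univ (X := X)).totallyBounded _ (half_pos hδ)
  lift t to Finset X using htfin
  refine ⟨(t ×ˢ t).sup fun q => k q.1 q.2, fun x y => ?_⟩
  obtain ⟨a, ha, hxa⟩ := Set.mem_iUnion₂.1 (htcover (Set.mem_univ (T x)))
  obtain ⟨b, hb, hyb⟩ := Set.mem_iUnion₂.1 (htcover (Set.mem_univ y))
  obtain ⟨l, hlen, hl⟩ := hk a b x y hxa hyb
  exact ⟨l, hlen.trans_le (Finset.le_sup (f := fun q : X × X => k q.1 q.2)
    (Finset.mk_mem_product ha hb)), hl⟩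

end PseudoPath

section Loops

variable {X E : Type*} [NormedAddCommGroup E] {T : X → X} {G : X → E}

theorem norm_sum_map_le {M : ℝ} (hG : ∀ x, ‖G x‖ ≤ M) (l : List X) :
    ‖(l.map G).sum‖ ≤ l.length * M := by
  induction l with
  | nil => simp
  | cons a l ih =>
    rw [List.map_cons, List.sum_cons, List.length_cons, Nat.cast_succ, add_one_mul, add_comm]
    exact (norm_add_le _ _).trans (add_le_add ih (hG a))

theorem sum_map_iterate_eq_birkhoffSum (n : ℕ) (u : X) :
    ((List.iterate T u n).map G).sum = birkhoffSum T G n u := by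
  induction n generalizing u with
  | zero => simp
  | succ n ih => rw [birkhoffSum_succ', List.iterate, List.map_cons, List.sum_cons, ih]

theorem sum_range_getD (l : List X) (p : X) :
    ∑ i ∈ Finset.range l.length, G (l.getD i p) = (l.map G).sum := by
  induction l with
  | nil => simp
  | cons a l ih =>
    simp only [List.length_cons, Finset.sum_range_succ', List.getD_cons_succ, ih,
      List.getD_cons_zero, List.map_cons, List.sum_cons, add_comm]

variable [MetricSpace X] {δ M : ℝ} {K : ℕ}

theorem exists_loop_norm_sum_sub_birkhoffSum_le (hδ : 0 < δ)
    (hK : ∀ x y, ∃ l : List X, l.length ≤ K ∧ IsPseudoPath T δ l x y) (hG : ∀ x, ‖G x‖ ≤ M)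
    (p u : X) (n : ℕ) :
    ∃ l, IsPseudoPath T δ l p p ∧ n ≤ l.length ∧
      ‖(l.map G).sum - birkhoffSum T G n u‖ ≤ 2 * K * M := by
  have hM : 0 ≤ M := (norm_nonneg _).trans (hG p)
  obtain ⟨l, hlK, hl⟩ := hK p u
  obtain ⟨l', hlK', hl'⟩ := hK (T^[n] u) p
  have hconnect : ∀ m : List X, m.length ≤ K → ‖(m.map G).sum‖ ≤ K * M := fun m hm =>
    (norm_sum_map_le hG m).trans (by gcongr)
  refine ⟨l ++ (List.iterate T u n ++ l'), hl.append ((isPseudoPath_iterate hδ n u).append hl'),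
    by simp only [List.length_append, List.length_iterate]; omega, ?_⟩
  calc ‖((l ++ (List.iterate T u n ++ l')).map G).sum - birkhoffSum T G n u‖
      = ‖(l.map G).sum + (l'.map G).sum‖ := by
        simp only [List.map_append, List.sum_append, sum_map_iterate_eq_birkhoffSum]
        congr 1
        abel
    _ ≤ K * M + K * M := norm_add_le_of_le (hconnect l hlK) (hconnect l' hlK')
    _ = 2 * K * M := by ring

theorem exists_loop_norm_sum_sub_sum_birkhoffSum_le (hδ : 0 < δ)
    (hK : ∀ x y, ∃ l : List X, l.length ≤ K ∧ IsPseudoPath T δ l x y) (hG : ∀ x, ‖G x‖ ≤ M)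
    (p : X) (ω : ℕ → X) (n L : ℕ) :
    ∃ l, IsPseudoPath T δ l p p ∧ L * n ≤ l.length ∧
      ‖(l.map G).sum - ∑ j ∈ Finset.range L, birkhoffSum T G n (ω j)‖ ≤ L * (2 * K * M) := by
  induction L with
  | zero => exact ⟨[], .nil p, by simp, by simp⟩
  | succ L ih =>
    obtain ⟨l, hl, hlen, hsum⟩ := ih
    obtain ⟨l', hl', hlen', hsum'⟩ := exists_loop_norm_sum_sub_birkhoffSum_le hδ hK hG p (ω L) n
    refine ⟨l ++ l', hl.append hl', ?_, ?_⟩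
    · rw [List.length_append, Nat.succ_mul]
      exact add_le_add hlen hlen'
    · rw [List.map_append, List.sum_append, Finset.sum_range_succ, add_sub_add_comm, Nat.cast_succ,
        add_one_mul]
      exact norm_add_le_of_le hsum hsum'

end Loops

section Sampling

variable {X E : Type*} [MeasurableSpace X] {μ : Measure X} [NormedAddCommGroup E]
  [NormedSpace ℝ E]

theorem integral_birkhoffSum {T : X → X} (hT : MeasurePreserving T μ μ) {G : X → E}
    (hG : Integrable G μ) (n : ℕ) : ∫ x, birkhoffSum T G n x ∂μ = n • ∫ x, G x ∂μ := by
  have hiter : ∀ i, ∫ x, G (T^[i] x) ∂μ = ∫ x, G x ∂μ := fun i => by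
    have hmap := (hT.iterate i).map_eq
    rw [← integral_map (hT.iterate i).aemeasurable (hmap.symm ▸ hG.aestronglyMeasurable), hmap]
  have hint : ∀ i, Integrable (fun x => G (T^[i] x)) μ := fun i =>
    (hT.iterate i).integrable_comp_of_integrable hG
  simp only [birkhoffSum]
  rw [integral_finsetSum _ fun i _ => hint i]
  simp only [hiter, Finset.sum_const, Finset.card_range]

variable [CompleteSpace E] [MeasurableSpace E] [BorelSpace E]

theorem exists_tendsto_average_integral [IsProbabilityMeasure μ] {G : X → E} (hG : Measurable G)
    (hGμ : Integrable G μ) :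
    ∃ ω : ℕ → X, Tendsto (fun L : ℕ => (L : ℝ)⁻¹ • ∑ j ∈ Finset.range L, G (ω j)) atTop
      (𝓝 (∫ x, G x ∂μ)) := by
  let ν := Measure.infinitePi fun _ : ℕ => μ
  have heval : ∀ j, MeasurePreserving (fun ω : ℕ → X => ω j) ν μ :=
    measurePreserving_eval_infinitePi _
  have hindep : ProbabilityTheory.iIndepFun (fun (j : ℕ) (ω : ℕ → X) => G (ω j)) ν :=
    ProbabilityTheory.iIndepFun_infinitePi (X := fun _ => G) fun _ => hG
  have hident : ∀ j, ProbabilityTheory.IdentDistrib (fun ω : ℕ → X => G (ω j))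
      (fun ω => G (ω 0)) ν ν := fun j =>
    (ProbabilityTheory.IdentDistrib.mk (heval j).aemeasurable (heval 0).aemeasurable
      ((heval j).map_eq.trans (heval 0).map_eq.symm)).comp hG
  have hlaw := ProbabilityTheory.strong_law_ae (μ := ν) (fun j ω => G (ω j))
    ((heval 0).integrable_comp_of_integrable hGμ) (fun _ _ hij => hindep.indepFun hij) hident
  have hmean : ∫ ω, G (ω 0) ∂ν = ∫ x, G x ∂μ := by
    rw [← integral_map (heval 0).aemeasurable ((heval 0).map_eq ▸ hGμ.aestronglyMeasurable),
      (heval 0).map_eq]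
  rw [hmean] at hlaw
  exact hlaw.exists

end Sampling

section PeriodicApproximation

theorem sum_range_mul_of_periodic {E : Type*} [AddCommMonoid E] {g : ℕ → E} {P : ℕ}
    (hg : Function.Periodic g P) (m : ℕ) :
    ∑ i ∈ Finset.range (m * P), g i = m • ∑ i ∈ Finset.range P, g i := by
  induction m with
  | zero => simp
  | succ m ih =>
    have hshift : ∀ i, g (m * P + i) = g i := fun i => by
      rw [add_comm, ← smul_eq_mul, hg.nsmul m i]
    rw [Nat.succ_mul, Finset.sum_range_add, ih, succ_nsmul]
    simp only [hshift]

variable {X E : Type*} [NormedAddCommGroup E] [NormedSpace ℝ E]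

theorem norm_birkhoffAverage_sub_le {T : X → X} {G : X → E} {c : E} {n : ℕ} (hn : 0 < n) {z : X}
    {η : ℝ} (h : ‖birkhoffSum T (fun x => G x - c) n z‖ ≤ n * η) :
    ‖birkhoffAverage ℝ T G n z - c‖ ≤ η := by
  have hn' : (0 : ℝ) < n := Nat.cast_pos.2 hn
  have hcenter : birkhoffAverage ℝ T G n z - c =
      (n : ℝ)⁻¹ • birkhoffSum T (fun x => G x - c) n z := by
    simp only [birkhoffAverage, birkhoffSum, Finset.sum_sub_distrib, Finset.sum_const,
      Finset.card_range, smul_sub, ← Nat.cast_smul_eq_nsmul ℝ, inv_smul_smul₀ hn'.ne']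
  rwa [hcenter, norm_smul, norm_inv, Real.norm_natCast, inv_mul_le_iff₀ hn']

variable [MeasurableSpace X] [CompleteSpace E] [SecondCountableTopology E] {T : X → X}
  {μ : Measure X} [IsProbabilityMeasure μ] {G : X → E} {η : ℝ}

theorem exists_norm_sum_birkhoffSum_le [MeasurableSpace E] [BorelSpace E]
    (hμ : MeasurePreserving T μ μ) (hG : Measurable G) (hGμ : Integrable G μ)
    (hG₀ : ∫ x, G x ∂μ = 0) (n : ℕ) (hη : 0 < η) :
    ∃ ω : ℕ → X, ∃ L > 0, ‖∑ j ∈ Finset.range L, birkhoffSum T G n (ω j)‖ ≤ L * η := by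
  have hmeas : Measurable fun x => birkhoffSum T G n x :=
    Finset.measurable_fun_sum _ fun i _ => hG.comp (hμ.measurable.iterate i)
  have hint : Integrable (fun x => birkhoffSum T G n x) μ :=
    integrable_finsetSum _ fun i _ => (hμ.iterate i).integrable_comp_of_integrable hGμ
  obtain ⟨ω, hω⟩ := exists_tendsto_average_integral hmeas hint
  rw [integral_birkhoffSum hμ hGμ, hG₀, smul_zero] at hω
  obtain ⟨L, hL, hL₀⟩ := ((hω.norm.eventually_le_const (norm_zero.trans_lt hη)).and
    (eventually_gt_atTop 0)).exists
  rw [norm_smul, norm_inv, Real.norm_natCast, inv_mul_le_iff₀ (Nat.cast_pos.2 hL₀)] at hL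
  exact ⟨ω, L, hL₀, hL⟩

variable [MetricSpace X] [CompactSpace X]

theorem IsTransitive.exists_isPeriodicPseudoOrbit_norm_sum_le [MeasurableSpace E]
    [BorelSpace E] (hT : IsTransitive T) (hμ : MeasurePreserving T μ μ) (hG : Measurable G) {M : ℝ}
    (hGM : ∀ x, ‖G x‖ ≤ M) (hG₀ : ∫ x, G x ∂μ = 0) {δ : ℝ} (hδ : 0 < δ) (hη : 0 < η) :
    ∃ x P, IsPeriodicPseudoOrbit T δ x P ∧ ‖∑ i ∈ Finset.range P, G (x i)‖ ≤ P * η := by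
  obtain ⟨p⟩ : Nonempty X := μ.nonempty_of_neZero
  obtain ⟨K, hK⟩ := hT.exists_isPseudoPath_length_le hδ
  obtain ⟨n, hn⟩ := exists_nat_ge (max 1 (2 * K * M / (η / 2)))
  obtain ⟨hn₁, hnK⟩ := max_le_iff.1 hn
  rw [div_le_iff₀ (half_pos hη)] at hnK
  have hint : Integrable G μ := .of_bound hG.aestronglyMeasurable M (.of_forall hGM)
  obtain ⟨ω, L, hL₀, hL⟩ := exists_norm_sum_birkhoffSum_le hμ hG hint hG₀ n (half_pos hη)
  obtain ⟨l, hl, hlen, hsum⟩ := exists_loop_norm_sum_sub_sum_birkhoffSum_le hδ hK hGM p ω n L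
  have hlen' : (L * n : ℝ) ≤ l.length := by exact_mod_cast hlen
  have hl₀ : 0 < l.length := Nat.cast_pos.1 ((by positivity : (0 : ℝ) < L * n).trans_le hlen')
  refine ⟨_, _, hl.isPeriodicPseudoOrbit hl₀, ?_⟩
  calc ‖∑ i ∈ Finset.range l.length, G (l.getD (i % l.length) p)‖
      = ‖(l.map G).sum‖ := by
        rw [← sum_range_getD l p]
        exact congrArg _ (Finset.sum_congr rfl fun i hi => by
          rw [Nat.mod_eq_of_lt (Finset.mem_range.1 hi)])
    _ ≤ ‖∑ j ∈ Finset.range L, birkhoffSum T G n (ω j)‖ + L * (2 * K * M) :=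
        (norm_le_insert' _ _).trans (add_le_add_right hsum _)
    _ ≤ L * (n * (η / 2)) + L * (n * (η / 2)) := by
        gcongr
        exact hL.trans (by gcongr; exact le_mul_of_one_le_left (half_pos hη).le hn₁)
    _ = L * n * η := by ring
    _ ≤ l.length * η := by gcongr

theorem exists_isUniformlyRegularlyRecurrent_norm_birkhoffAverage_sub_integral_le
    [BorelSpace X] (hT : Continuous T) (htrans : IsTransitive T) (hS : HasShadowing T)
    (hμ : MeasurePreserving T μ μ) (hG : Continuous G) (hη : 0 < η) :
    ∃ z, IsUniformlyRegularlyRecurrent T z ∧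
      ∃ P > 0, ∀ m > 0, ‖birkhoffAverage ℝ T G (m * P) z - ∫ x, G x ∂μ‖ ≤ η := by
  borelize E
  set c : E := ∫ x, G x ∂μ
  let G₀ : X → E := fun x => G x - c
  have hG₀ : Continuous G₀ := hG.sub continuous_const
  obtain ⟨M, hM⟩ := isCompact_univ.exists_bound_of_continuousOn hG₀.continuousOn
  have hint : Integrable G μ := hG.integrable_of_hasCompactSupport (.of_compactSpace G)
  have hcenter : ∫ x, G₀ x ∂μ = 0 := by
    rw [integral_sub hint (integrable_const c), integral_const, probReal_univ, one_smul, sub_self]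
  obtain ⟨ρ, hρ, hunif⟩ := Metric.uniformContinuous_iff_le.1
    (CompactSpace.uniformContinuous_of_continuous hG₀) (η / 2) (half_pos hη)
  obtain ⟨δ, hδ, htrace⟩ := hS.exists_isUniformlyRegularlyRecurrent hT hρ
  obtain ⟨x, P, hx, hxsum⟩ := htrans.exists_isPeriodicPseudoOrbit_norm_sum_le hμ hG₀.measurable
    (fun x => hM x (Set.mem_univ x)) hcenter hδ (half_pos hη)
  obtain ⟨z, hz, hzx⟩ := htrace x P hx
  refine ⟨z, hz, P, hx.pos, fun m hm => norm_birkhoffAverage_sub_le (Nat.mul_pos hm hx.pos) ?_⟩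
  have hclose : ‖birkhoffSum T G₀ (m * P) z - ∑ i ∈ Finset.range (m * P), G₀ (x i)‖ ≤
      (m * P : ℕ) * (η / 2) := by
    rw [birkhoffSum, ← Finset.sum_sub_distrib]
    refine (norm_sum_le_of_le (n := fun _ => η / 2) _ fun i _ => ?_).trans_eq (by simp)
    exact dist_eq_norm (G₀ (T^[i] z)) _ ▸ hunif (hzx i)
  have hperiodic : ‖∑ i ∈ Finset.range (m * P), G₀ (x i)‖ ≤ (m * P : ℕ) * (η / 2) := by
    rw [sum_range_mul_of_periodic (g := fun i => G₀ (x i)) (hx.periodic.comp G₀), Nat.cast_mul,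
      mul_assoc]
    exact norm_nsmul_le.trans (by gcongr)
  calc ‖birkhoffSum T G₀ (m * P) z‖
      ≤ (m * P : ℕ) * (η / 2) + (m * P : ℕ) * (η / 2) :=
        (norm_le_insert' _ _).trans (add_le_add hperiodic hclose)
    _ = (m * P : ℕ) * η := by ring

end PeriodicApproximation

section EmpiricalMeasures

open scoped BoundedContinuousFunction

variable {X : Type*} [MeasurableSpace X] {T : X → X} {z : X}

/-- The uniform distribution on the first `n` points of the orbit of `z`, counted with multiplicity.
Its integrals are Birkhoff averages, and its limits as `n → ∞` are invariant. -/
noncomputable def empiricalMeasure (T : X → X) (z : X) (n : ℕ) [NeZero n] : ProbabilityMeasure X :=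
  ⟨(n : ℝ≥0∞)⁻¹ • ∑ i ∈ Finset.range n, Measure.dirac (T^[i] z), ⟨by
    simp [ENNReal.inv_mul_cancel (Nat.cast_ne_zero.2 (NeZero.ne n)) (ENNReal.natCast_ne_top n)]⟩⟩

theorem ae_empiricalMeasure {p : X → Prop} (hp : MeasurableSet {x | p x})
    (h : ∀ i, p (T^[i] z)) (n : ℕ) [NeZero n] :
    ∀ᵐ x ∂(empiricalMeasure T z n : Measure X), p x := by
  refine Measure.ae_smul_measure ?_ _
  rw [ae_finsetSum_measure_iff]
  exact fun i _ => (ae_dirac_iff hp).2 (h i)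

theorem integral_empiricalMeasure [TopologicalSpace X] [OpensMeasurableSpace X] (n : ℕ) [NeZero n]
    (f : X →ᵇ ℝ) : ∫ x, f x ∂(empiricalMeasure T z n : Measure X) = birkhoffAverage ℝ T f n z := by
  have hdirac : ∀ x, ∫ y, f y ∂Measure.dirac x = f x := fun x =>
    integral_dirac' _ x f.continuous.stronglyMeasurable
  rw [empiricalMeasure, ProbabilityMeasure.coe_mk, integral_smul_measure,
    integral_finsetSum_measure fun i _ => f.integrable _]
  simp [hdirac, birkhoffAverage, birkhoffSum]

variable [TopologicalSpace X] [BorelSpace X] [HasOuterApproxClosed X] {ι : Type*} {L : Filter ι}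
  [L.NeBot]

/-- Krylov–Bogolyubov. -/
theorem measurePreserving_of_tendsto_empiricalMeasure (hT : Continuous T) {n : ι → ℕ}
    [∀ i, NeZero (n i)] (hn : Tendsto n L atTop) {ν : ProbabilityMeasure X}
    (hν : Tendsto (fun i => empiricalMeasure T z (n i)) L (𝓝 ν)) :
    MeasurePreserving T (ν : Measure X) (ν : Measure X) := by
  have hlim : ∀ f : X →ᵇ ℝ, Tendsto (fun i => birkhoffAverage ℝ T f (n i) z) L
      (𝓝 (∫ x, f x ∂(ν : Measure X))) := fun f => by
    simpa only [integral_empiricalMeasure] using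
      ProbabilityMeasure.tendsto_iff_forall_integral_tendsto.1 hν f
  refine ⟨hT.measurable, ext_of_forall_integral_eq_of_IsFiniteMeasure fun f => ?_⟩
  rw [integral_map hT.measurable.aemeasurable f.continuous.measurable.aestronglyMeasurable]
  have hshift : Tendsto (fun i => birkhoffAverage ℝ T f (n i) (T z)) L
      (𝓝 (∫ x, f (T x) ∂(ν : Measure X))) := by
    refine (hlim (f.compContinuous ⟨T, hT⟩)).congr fun i => ?_
    simp only [birkhoffAverage, birkhoffSum, BoundedContinuousFunction.compContinuous_apply,
      ContinuousMap.coe_mk, ← Function.iterate_succ_apply' T, Function.iterate_succ_apply]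
  exact sub_eq_zero.1 <| tendsto_nhds_unique (hshift.sub (hlim f)) <|
    (tendsto_birkhoffAverage_apply_sub_birkhoffAverage' ℝ f.isBounded_range T z).comp hn

theorem ae_of_tendsto_empiricalMeasure {p : X → Prop} (hp : IsClosed {x | p x})
    (h : ∀ i, p (T^[i] z)) {n : ι → ℕ} [∀ i, NeZero (n i)] {ν : ProbabilityMeasure X}
    (hν : Tendsto (fun i => empiricalMeasure T z (n i)) L (𝓝 ν)) :
    ∀ᵐ x ∂(ν : Measure X), p x := by
  have hone : ∀ i, (empiricalMeasure T z (n i) : Measure X) {x | p x} = 1 := fun i =>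
    (mem_ae_iff_prob_eq_one hp.measurableSet).1 (ae_empiricalMeasure hp.measurableSet h (n i))
  have hlimsup := ProbabilityMeasure.limsup_measure_closed_le_of_tendsto hν hp
  simp only [hone, limsup_const] at hlimsup
  exact (mem_ae_iff_prob_eq_one hp.measurableSet).2 (le_antisymm prob_le_one hlimsup)

end EmpiricalMeasures

section Density

open scoped BoundedContinuousFunction

variable {X : Type*} [MetricSpace X] [CompactSpace X] [MeasurableSpace X] [BorelSpace X]
  {T : X → X}

theorem IsUniformlyRegularlyRecurrent.entropy_eq_zero_of_tendsto_empiricalMeasure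
    {z : X} (hz : IsUniformlyRegularlyRecurrent T z) (hT : Continuous T) {ι : Type*}
    {L : Filter ι} [L.NeBot] {n : ι → ℕ} [∀ i, NeZero (n i)] {ν : ProbabilityMeasure X}
    (hν : Tendsto (fun i => empiricalMeasure T z (n i)) L (𝓝 ν))
    (hinv : MeasurePreserving T (ν : Measure X) (ν : Measure X)) :
    entropy T (ν : Measure X) = 0 := by
  refine entropy_eq_zero_of_ae_dist_iterate_le hinv fun r hr => ?_
  obtain ⟨N, hN, hNr⟩ := hz r hr
  have hclosed : IsClosed {x | ∀ m, dist (T^[m * N] x) x ≤ r} := by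
    simp only [Set.ofPred_forall]
    exact isClosed_iInter fun m =>
      isClosed_le ((hT.iterate _).dist continuous_id) continuous_const
  refine ⟨N, hN, ae_of_tendsto_empiricalMeasure hclosed (fun i m => ?_) hν⟩
  rw [← Function.iterate_add_apply, add_comm]
  exact hNr i m

theorem exists_entropy_eq_zero_abs_integral_sub_le (hT : Continuous T) (htrans : IsTransitive T)
    (hS : HasShadowing T) {μ : Measure X} [IsProbabilityMeasure μ] (hμ : MeasurePreserving T μ μ)
    (F : Finset (X →ᵇ ℝ)) {ε : ℝ} (hε : 0 < ε) :
    ∃ ν : ProbabilityMeasure X, MeasurePreserving T (ν : Measure X) (ν : Measure X) ∧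
      entropy T (ν : Measure X) = 0 ∧
      ∀ f ∈ F, |∫ x, f x ∂(ν : Measure X) - ∫ x, f x ∂μ| ≤ ε := by
  let G : X → F → ℝ := fun x f => f.1 x
  have hG : Continuous G := continuous_pi fun f => f.1.continuous
  obtain ⟨z, hz, P, hP, hclose⟩ :=
    exists_isUniformlyRegularlyRecurrent_norm_birkhoffAverage_sub_integral_le hT htrans hS hμ hG hε
  have hne : ∀ i : ℕ, NeZero ((i + 1) * P) := fun i => ⟨by positivity⟩
  obtain ⟨ν, φ, hφ, hν⟩ :=
    CompactSpace.tendsto_subseq fun i : ℕ => empiricalMeasure T z ((i + 1) * P)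
  have hlen : Tendsto (fun i => (φ i + 1) * P) atTop atTop :=
    ((tendsto_add_atTop_nat 1).comp hφ.tendsto_atTop).atTop_mul_const' hP
  have hinv := measurePreserving_of_tendsto_empiricalMeasure hT hlen hν
  refine ⟨ν, hinv, hz.entropy_eq_zero_of_tendsto_empiricalMeasure hT hν hinv, fun f hf => ?_⟩
  have hlim := ((ProbabilityMeasure.tendsto_iff_forall_integral_tendsto.1 hν f).sub_const
    (∫ x, f x ∂μ)).abs
  refine le_of_tendsto hlim (.of_forall fun i => ?_)
  have hcoord := (norm_le_pi_norm _ (⟨f, hf⟩ : F)).trans (hclose (φ i + 1) (φ i).succ_pos)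
  rw [Pi.sub_apply, eval_integral fun g : F => g.1.integrable μ] at hcoord
  simpa [integral_empiricalMeasure, birkhoffAverage, birkhoffSum, G] using hcoord

theorem dense_zeroEntropyMeasures (hT : Continuous T) (htrans : IsTransitive T)
    (hS : HasShadowing T) : Dense (zeroEntropyMeasures T) := by
  classical
  intro μ
  choose ν hinv hent hν using fun q : Finset (X →ᵇ ℝ) × ℕ =>
    exists_entropy_eq_zero_abs_integral_sub_le hT htrans hS μ.2 q.1
      (ε := 1 / ((q.2 : ℝ) + 1)) Nat.one_div_pos_of_nat
  refine mem_closure_of_tendsto (f := fun q => (⟨ν q, hinv q⟩ : invariantMeasures T)) (b := atTop)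
    ?_ (.of_forall hent)
  rw [tendsto_subtype_rng, ProbabilityMeasure.tendsto_iff_forall_integral_tendsto]
  intro f
  have hlim : Tendsto (fun q : Finset (X →ᵇ ℝ) × ℕ => 1 / ((q.2 : ℝ) + 1)) atTop (𝓝 0) :=
    tendsto_one_div_add_atTop_nhds_zero_nat.comp (tendsto_snd.mono_left prod_atTop_atTop_eq.ge)
  rw [tendsto_iff_dist_tendsto_zero]
  refine squeeze_zero' (.of_forall fun _ => dist_nonneg) ?_ hlim
  filter_upwards [eventually_ge_atTop (({f} : Finset (X →ᵇ ℝ)), 0)] with q hq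
  exact hν q f (hq.1 (Finset.mem_singleton_self f))

end Density

theorem isGδ_setOf_le_of_upperSemicontinuous {Y α : Type*} [TopologicalSpace Y] [LinearOrder α]
    [TopologicalSpace α] [OrderTopology α] [DenselyOrdered α] [FirstCountableTopology α]
    {f : Y → α} (hf : UpperSemicontinuous f) (a : α) : IsGδ {y | f y ≤ a} := by
  by_cases ha : IsMax a
  · rw [Set.eq_univ_of_forall (s := {y | f y ≤ a}) fun y => ha.isTop (f y)]
    exact .univ
  obtain ⟨b, hb⟩ := not_isMax_iff.1 ha
  obtain ⟨u, -, hu, hlim⟩ := exists_seq_strictAnti_tendsto' hb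
  have hInter : {y | f y ≤ a} = ⋂ n, f ⁻¹' Set.Iio (u n) := by
    ext y
    rw [Set.mem_iInter]
    exact ⟨fun hy n => lt_of_le_of_lt hy (hu n).1,
      fun hy => ge_of_tendsto' hlim fun n => (hy n).le⟩
  rw [hInter]
  exact .iInter_of_isOpen fun n => hf.isOpen_preimage (u n)

end TopDyn

theorem mainTheorem8 {X : Type*} [MetricSpace X] [CompactSpace X] [MeasurableSpace X]
    [BorelSpace X] (T : X → X) (hT : Continuous T)
    (htrans : TopDyn.IsTransitive T) (hshadow : TopDyn.HasShadowing T) :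
    Dense (TopDyn.zeroEntropyMeasures T) ∧
      (UpperSemicontinuous (fun μ : TopDyn.invariantMeasures T =>
          TopDyn.entropy T ((μ : ProbabilityMeasure X) : Measure X)) →
        TopDyn.zeroEntropyMeasures T ∈ residual (TopDyn.invariantMeasures T)) := by
  have hdense := TopDyn.dense_zeroEntropyMeasures hT htrans hshadow
  refine ⟨hdense, fun husc => residual_of_dense_Gδ ?_ hdense⟩
  simpa only [TopDyn.zeroEntropyMeasures, nonpos_iff_eq_zero] using
    TopDyn.isGδ_setOf_le_of_upperSemicontinuous husc 0
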